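/- Let $X_g=\{(x,y)\in\mathbb{R}^2 : xy=0\}$ carry the gluing diffeology, that is, the quotient diffeology from $(\mathbb{R}\times\{0\})\sqcup(\{0\}\times\mathbb{R})$ with the two origins identified. For a diffeological space $X$ and $x\in X$, let $T_xX$ be the colimit in real vector spaces of $T_0U$ over the category of pointed plots $(U,0)\to(X,x)$ with $U$ open in some $\mathbb{R}^n$ (a morphism being a smooth pointed map $(U,0)\to(V,0)$ commuting with the plots). The internal tangent bundle $T^{\mathrm{dvs}}X\to X$ is $\coprod_{x\in X}T_xX$ with the smallest diffeology that contains all the maps $Tp:TU\to\coprod_x T_xX$ induced by plots $p:U\to X$ (that is, makes them smooth) and makes the projection to $X$ a diffeological vector pseudo-bundle (the projection, fibrewise addition, scalar multiplication and the zero section are smooth). Let $E_1=\{(x,0,v): x,v\in\mathbb{R}\}\cup\{(0,y,0): y\in\mathbb{R}\}\subset\mathbb{R}^3$ with the diffeology obtained by gluing the plane $(\mathbb{R}\times\{0\})\times\mathbb{R}$ and the line $(\{0\}\times\mathbb{R})\times\{0\}$ at $(0,0,0)$, and likewise $E_2=\{(x,0,0): x\in\mathbb{R}\}\cup\{(0,y,v):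 y,v\in\mathbb{R}\}$, the gluing of the line $(\mathbb{R}\times\{0\})\times\{0\}$ and the plane $(\{0\}\times\mathbb{R})\times\mathbb{R}$ at $(0,0,0)$. Both are diffeological vector pseudo-bundles over $X_g$ via $(x,y,v)\mapsto(x,y)$, with vector space structure in the coordinate $v$; $E_i$ has $1$-dimensional fibres over the $i$-th axis and $0$-dimensional fibres elsewhere. Let $E_1\oplus E_2$ be their direct sum over $X_g$: fibrewise the direct sum, with the smallest diffeology making it a diffeological vector pseudo-bundle over $X_g$ and the canonical maps $E_i\to E_1\oplus E_2$ smooth. Then $T^{\mathrm{dvs}}X_g\cong E_1\oplus E_2$ as diffeological vector pseudo-bundles over $X_g$, i.e. there are mutually inverse smooth, fibrewise linear maps over $X_g$ between them. -/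

import Mathlib

open scoped ContDiff
open Diffeology

noncomputable section

namespace DiffBundle

universe u v w

/-- The Euclidean space `ℝⁿ`. -/
abbrev Euc (n : ℕ) : Type := EuclideanSpace ℝ (Fin n)

/-! ### Plots on open subsets and glued diffeologies -/

/-- `p` restricts to a plot `U → X`, where `U` is an open subset of `ℝⁿ`. (Mathlib's plots have domain
`ℝⁿ`; a map `U → X` is a plot when its composites with all smooth maps `ℝᵐ → U` are.)
The values of `p` outside `U` are irrelevant. -/
def IsPlotOn {X : Type u} [DiffeologicalSpace X] {n : ℕ} (U : Set (Euc n)) (p : Euc n → X) : Prop :=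
  ∀ (m : ℕ) (f : Euc m → Euc n), ContDiff ℝ ∞ f → (∀ x, f x ∈ U) → IsPlot (p ∘ f)

/-- The smallest diffeology on `Z` that makes `f : X → Z` and `g : Y → Z` smooth. When `f` and `g` are
jointly surjective, this is the quotient diffeology along the induced surjection `X ⨿ Y → Z`. -/
@[reducible]
def gluedDiffeology {X : Type u} {Y : Type v} {Z : Type w}
    [DiffeologicalSpace X] [DiffeologicalSpace Y] (f : X → Z) (g : Y → Z) : DiffeologicalSpace Z :=
  DiffeologicalSpace.generateFrom
    {q | (∃ p : Euc q.1 → X, IsPlot p ∧ q.2 = f ∘ p) ∨ (∃ p : Euc q.1 → Y, IsPlot p ∧ q.2 = g ∘ p)}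

lemma gluedDiffeology_le {X : Type u} {Y : Type v} {Z : Type w}
    [DiffeologicalSpace X] [DiffeologicalSpace Y] {f : X → Z} {g : Y → Z} {d : DiffeologicalSpace Z}
    (hf : DSmooth f) (hg : DSmooth g) : gluedDiffeology f g ≤ d := by
  refine DiffeologicalSpace.generateFrom_le_iff_subset_toPlots.2 ?_
  rintro ⟨n, q⟩ (⟨p, hp, h⟩ | ⟨p, hp, h⟩) <;> dsimp only at p hp h <;> subst h
  · exact hf n p hp
  · exact hg n p hp

lemma IsPlotOn.mono {X : Type u} [DiffeologicalSpace X] {n : ℕ} {U V : Set (Euc n)} {p : Euc n → X}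
    (h : IsPlotOn U p) (hV : V ⊆ U) : IsPlotOn V p :=
  fun m f hf hfV => h m f hf fun x => hV (hfV x)

/-- Plots of a glued diffeology are the maps that locally lift to one of the pieces. -/
lemma isPlot_glued_iff {X : Type u} {Y : Type v} {Z : Type w}
    [DiffeologicalSpace X] [DiffeologicalSpace Y] {f : X → Z} {g : Y → Z}
    (hfg : ∀ z, (∃ x, f x = z) ∨ ∃ y, g y = z) {n : ℕ} {q : Euc n → Z} :
    @IsPlot _ (gluedDiffeology f g) n q ↔ ∀ x, ∃ V : Set (Euc n), IsOpen V ∧ x ∈ V ∧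
      ((∃ a, IsPlotOn V a ∧ Set.EqOn q (f ∘ a) V) ∨ (∃ a, IsPlotOn V a ∧ Set.EqOn q (g ∘ a) V)) := by
  constructor
  · intro hq
    let core : DiffeologicalSpace.CorePlotsOn Z :=
      { isPlotOn := fun {n U} _ q => ∀ x ∈ U, ∃ V : Set (Euc n), IsOpen V ∧ x ∈ V ∧
          ((∃ a, IsPlotOn V a ∧ Set.EqOn q (f ∘ a) V) ∨ (∃ a, IsPlotOn V a ∧ Set.EqOn q (g ∘ a) V))
        isPlotOn_congr := fun {_ _} hU {_ _} h => by
          have aux : ∀ {n : ℕ} {U : Set (Euc n)} (_ : IsOpen U) {p q : Euc n → Z},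
              Set.EqOn p q U → (∀ x ∈ U, ∃ V : Set (Euc n), IsOpen V ∧ x ∈ V ∧
                ((∃ a, IsPlotOn V a ∧ Set.EqOn p (f ∘ a) V) ∨
                  (∃ a, IsPlotOn V a ∧ Set.EqOn p (g ∘ a) V))) →
              ∀ x ∈ U, ∃ V : Set (Euc n), IsOpen V ∧ x ∈ V ∧
                ((∃ a, IsPlotOn V a ∧ Set.EqOn q (f ∘ a) V) ∨
                  (∃ a, IsPlotOn V a ∧ Set.EqOn q (g ∘ a) V)) := by
            intro n U hU p q h hp x hx
            obtain ⟨V, hV, hxV, hp⟩ := hp x hx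
            refine ⟨V ∩ U, hV.inter hU, ⟨hxV, hx⟩, ?_⟩
            refine hp.imp ?_ ?_ <;> rintro ⟨a, ha, hpa⟩ <;>
              exact ⟨a, ha.mono Set.inter_subset_left,
                fun y hy => (h hy.2).symm.trans (hpa hy.1)⟩
          exact ⟨aux hU h, aux hU h.symm⟩
        isPlot_const := fun {n} z x _ => by
          refine ⟨Set.univ, isOpen_univ, trivial, ?_⟩
          refine (hfg z).imp ?_ ?_ <;> rintro ⟨y, rfl⟩ <;>
            exact ⟨fun _ => y, fun _ _ _ _ => isPlot_const, fun _ _ => rfl⟩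
        isPlotOn_reparam := by
          intro n m U V hU hV p h hm hp hh x hx
          obtain ⟨W, hW, hxW, hp⟩ := hp (h x) (hm hx)
          refine ⟨V ∩ h ⁻¹' W, hh.continuousOn.isOpen_inter_preimage hV hW, ⟨hx, hxW⟩, ?_⟩
          refine hp.imp ?_ ?_ <;> rintro ⟨a, ha, hpa⟩ <;>
            exact ⟨a ∘ h, fun k e he heV =>
              ha k (h ∘ e) (hh.comp_contDiff he fun y => (heV y).1) fun y => (heV y).2,
              fun y hy => hpa hy.2⟩
        locality := fun {n U} _ p hp x hx => by
          obtain ⟨V, _, hxV, h⟩ := hp x hx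
          exact h x hxV }
    have hle : gluedDiffeology f g ≤ DiffeologicalSpace.ofCorePlotsOn core := by
      refine DiffeologicalSpace.generateFrom_le_iff.2 fun n p hp x _ => ?_
      refine ⟨Set.univ, isOpen_univ, trivial, ?_⟩
      refine hp.imp ?_ ?_ <;> rintro ⟨a, ha, h⟩ <;>
        exact ⟨a, fun m e he _ => isPlot_reparam ha he, fun y _ => congrFun h y⟩
    exact fun x => DiffeologicalSpace.le_iff'.1 hle n q hq x trivial
  · intro h
    refine (gluedDiffeology f g).locality fun x => ?_
    obtain ⟨V, hV, hxV, h⟩ := h x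
    refine ⟨V, hV, hxV, fun {m e} heV he => ?_⟩
    refine DiffeologicalSpace.isPlot_generatedFrom_of_mem ?_
    refine h.imp ?_ ?_ <;> rintro ⟨a, ha, hqa⟩ <;>
      exact ⟨a ∘ e, ha m e he heV, funext fun y => hqa (heV y)⟩

/-! ### Diffeological vector pseudo-bundles

A map `π : T → B` with vector space structures on its fibres is presented by the family `E` of its
fibres, so that the total space is `Σ b, E b` and `π` is `Sigma.fst`. -/

section PseudoBundle

variable {B : Type u} [DiffeologicalSpace B] (E : B → Type v)
  [∀ b, AddCommGroup (E b)] [∀ b, Module ℝ (E b)]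

/-- The diffeology `d` on the total space makes `Σ b, E b → B` a diffeological vector pseudo-bundle: the
projection, the fibrewise addition `E ×_B E → E`, the scalar multiplication `ℝ × E → E` and the zero
section are smooth, i.e. send plots to plots. A plot of `E ×_B E` is a pair of plots of `E` over the
same map to `B`; a plot of `ℝ × E` is a pair of plots. -/
structure IsPseudoBundle (d : DiffeologicalSpace (Σ b, E b)) : Prop where
  smooth_proj : DSmooth (Sigma.fst : (Σ b, E b) → B)
  smooth_add : ∀ (n : ℕ) (b : Euc n → B) (s t : ∀ x, E (b x)),
    IsPlot (fun x => (⟨b x, s x⟩ : Σ b, E b)) → IsPlot (fun x => (⟨b x, t x⟩ : Σ b, E b)) →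
      IsPlot (fun x => (⟨b x, s x + t x⟩ : Σ b, E b))
  smooth_smul : ∀ (n : ℕ) (r : Euc n → ℝ) (b : Euc n → B) (s : ∀ x, E (b x)),
    IsPlot r → IsPlot (fun x => (⟨b x, s x⟩ : Σ b, E b)) →
      IsPlot (fun x => (⟨b x, r x • s x⟩ : Σ b, E b))
  smooth_zero : DSmooth (fun b : B => (⟨b, 0⟩ : Σ b, E b))

/-- The dvsification of a diffeology `d` on the total space: the smallest diffeology that contains `d`
and makes the projection a diffeological vector pseudo-bundle. -/
@[reducible]
def dvsification (d : DiffeologicalSpace (Σ b, E b)) : DiffeologicalSpace (Σ b, E b) :=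
  sInf {d' | d ≤ d' ∧ IsPseudoBundle E d'}

/-- The largest diffeology on the total space for which the projection is smooth. -/
@[reducible]
def projDiffeology : DiffeologicalSpace (Σ b, E b) where
  plots n := {p | IsPlot (Sigma.fst ∘ p)}
  constant_plots _ := isPlot_const
  plot_reparam hp hf := isPlot_reparam hp hf
  locality {n p} hp := DiffeologicalSpace.locality (p := Sigma.fst ∘ p) fun x =>
    let ⟨U, hU, hx, h⟩ := hp x
    ⟨U, hU, hx, fun hf hf' => h hf hf'⟩

lemma isPseudoBundle_projDiffeology : IsPseudoBundle E (projDiffeology E) where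
  smooth_proj _ _ hp := hp
  smooth_add _ _ _ _ hs _ := hs
  smooth_smul _ _ _ _ _ hs := hs
  smooth_zero _ _ hp := hp

variable {E}

/-- If the projection is smooth, then the dvsification is a diffeological vector pseudo-bundle. -/
lemma isPseudoBundle_dvsification {d : DiffeologicalSpace (Σ b, E b)}
    (hd : DSmooth (Sigma.fst : (Σ b, E b) → B)) : IsPseudoBundle E (dvsification E d) := by
  have key : ∀ {n : ℕ} {p : Euc n → Σ b, E b}, @IsPlot _ (dvsification E d) n p ↔
      ∀ d' : DiffeologicalSpace (Σ b, E b), d ≤ d' ∧ IsPseudoBundle E d' → @IsPlot _ d' n p :=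
    fun {n p} => DiffeologicalSpace.isPlot_sInf_iff
  refine ⟨fun n p hp => ?_, fun n b s t hs ht => ?_, fun n r b s hr hs => ?_, fun n p hp => ?_⟩
  · exact key.1 hp (projDiffeology E)
      ⟨DiffeologicalSpace.le_iff'.2 fun n p hp => hd n p hp, isPseudoBundle_projDiffeology E⟩
  · exact key.2 fun d' h => h.2.smooth_add n b s t (key.1 hs d' h) (key.1 ht d' h)
  · exact key.2 fun d' h => h.2.smooth_smul n r b s hr (key.1 hs d' h)
  · exact key.2 fun d' h => h.2.smooth_zero n p hp

end PseudoBundle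

/-- A diffeological vector pseudo-bundle over `B`. -/
structure PseudoBundle (B : Type u) [DiffeologicalSpace B] where
  /-- The fibre over a point of `B`. -/
  Fibre : B → Type v
  [addCommGroup : ∀ b, AddCommGroup (Fibre b)]
  [module : ∀ b, Module ℝ (Fibre b)]
  /-- The diffeology of the total space. -/
  diffeology : DiffeologicalSpace (Σ b, Fibre b)
  isPseudoBundle : IsPseudoBundle Fibre diffeology

attribute [instance] PseudoBundle.addCommGroup PseudoBundle.module PseudoBundle.diffeology

section Maps

variable {B : Type u} [DiffeologicalSpace B]

/-- A bundle map over `B`: a smooth map of total spaces over `B` that is linear on each fibre. -/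
structure BundleMap (E : PseudoBundle.{u, v} B) (F : PseudoBundle.{u, w} B) where
  /-- The linear maps between the fibres. -/
  onFibre : ∀ b, E.Fibre b →ₗ[ℝ] F.Fibre b
  smooth : DSmooth (fun e : Σ b, E.Fibre b => (⟨e.1, onFibre e.1 e.2⟩ : Σ b, F.Fibre b))

/-- `E` and `F` are isomorphic as diffeological vector pseudo-bundles over `B`. -/
def Isomorphic (E : PseudoBundle.{u, v} B) (F : PseudoBundle.{u, w} B) : Prop :=
  ∃ (f : BundleMap E F) (g : BundleMap F E),
    (∀ b (e : E.Fibre b), g.onFibre b (f.onFibre b e) = e) ∧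
    (∀ b (e : F.Fibre b), f.onFibre b (g.onFibre b e) = e)

/-- The canonical map `E → E ⊕ F` on total spaces. -/
def sumInl (E : PseudoBundle.{u, v} B) (F : PseudoBundle.{u, w} B)
    (e : Σ b, E.Fibre b) : Σ b, E.Fibre b × F.Fibre b := ⟨e.1, (e.2, 0)⟩

/-- The canonical map `F → E ⊕ F` on total spaces. -/
def sumInr (E : PseudoBundle.{u, v} B) (F : PseudoBundle.{u, w} B)
    (e : Σ b, F.Fibre b) : Σ b, E.Fibre b × F.Fibre b := ⟨e.1, (0, e.2)⟩

/-- The direct sum `E ⊕ F` over `B`: its fibres are the direct sums of the fibres, and its diffeology is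
the dvsification of the one generated by the canonical maps `E → E ⊕ F` and `F → E ⊕ F`. -/
def directSum (E : PseudoBundle.{u, v} B) (F : PseudoBundle.{u, w} B) :
    PseudoBundle.{u, max v w} B where
  Fibre b := E.Fibre b × F.Fibre b
  diffeology := dvsification _ (gluedDiffeology (sumInl E F) (sumInr E F))
  isPseudoBundle := isPseudoBundle_dvsification <| by
    have h : gluedDiffeology (sumInl E F) (sumInr E F) ≤ projDiffeology _ :=
      gluedDiffeology_le E.isPseudoBundle.smooth_proj F.isPseudoBundle.smooth_proj
    exact fun n p hp => DiffeologicalSpace.le_iff'.1 h n p hp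

end Maps

/-! ### The internal tangent bundle -/

section Tangent

variable {X : Type u} [DiffeologicalSpace X]

/-- A pointed plot `(U, 0) → (X, x)`, with `U` an open subset of some `ℝⁿ` containing `0`. -/
structure PointedPlot (x : X) where
  /-- The dimension `n` of the domain. -/
  dim : ℕ
  /-- The domain `U`. -/
  dom : Set (Euc dim)
  isOpen_dom : IsOpen dom
  zero_mem : (0 : Euc dim) ∈ dom
  /-- The map; only its values on `U` matter. -/
  toFun : Euc dim → X
  isPlotOn : IsPlotOn dom toFun
  map_zero : toFun 0 = x

/-- `f` is a morphism `p → q` of pointed plots: a smooth map `(U, 0) → (V, 0)` with `q ∘ f = p`. -/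
structure PointedPlot.IsMorphism {x : X} (p q : PointedPlot x) (f : Euc p.dim → Euc q.dim) :
    Prop where
  contDiffOn : ContDiffOn ℝ ∞ f p.dom
  mapsTo : Set.MapsTo f p.dom q.dom
  map_zero : f 0 = 0
  comp_eq : Set.EqOn (q.toFun ∘ f) p.toFun p.dom

open scoped Classical in
/-- The relations `[p, v] = [q, f_* v]` defining the tangent space as a colimit, where `f : p → q` is a
morphism of pointed plots and `f_*` is its derivative at `0`. -/
def tangentRelations (x : X) : Submodule ℝ (DirectSum (PointedPlot x) fun p => Euc p.dim) :=
  Submodule.span ℝ {w | ∃ (p q : PointedPlot x) (f : Euc p.dim → Euc q.dim) (v : Euc p.dim),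
    p.IsMorphism q f ∧
      w = DirectSum.lof ℝ (PointedPlot x) (fun p => Euc p.dim) p v -
        DirectSum.lof ℝ (PointedPlot x) (fun p => Euc p.dim) q (fderiv ℝ f 0 v)}

/-- The tangent space `T_x X`: the colimit in vector spaces of `T_0 U = ℝⁿ` over the category of pointed
plots `(U, 0) → (X, x)`, built as the quotient of the direct sum. -/
abbrev TangentSpaceAt (x : X) : Type u :=
  (DirectSum (PointedPlot x) fun p => Euc p.dim) ⧸ tangentRelations x

open scoped Classical in
/-- The canonical map `p_* : T_0 U → T_x X` of a pointed plot `p : (U, 0) → (X, x)`. -/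
def PointedPlot.tangent {x : X} (p : PointedPlot x) : Euc p.dim →ₗ[ℝ] TangentSpaceAt x :=
  (tangentRelations x).mkQ ∘ₗ DirectSum.lof ℝ (PointedPlot x) (fun p => Euc p.dim) p

/-- The pointed plot `w ↦ p (a + w)` obtained from a plot `p : U → X` by moving `a ∈ U` to the origin. -/
def pointedAt {n : ℕ} {U : Set (Euc n)} (hU : IsOpen U) {p : Euc n → X} (hp : IsPlotOn U p)
    {a : Euc n} (ha : a ∈ U) : PointedPlot (p a) where
  dim := n
  dom := {w | a + w ∈ U}
  isOpen_dom := hU.preimage (by fun_prop)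
  zero_mem := by simpa using ha
  toFun w := p (a + w)
  isPlotOn m f hf hfU := hp m (fun y => a + f y) (contDiff_const.add hf) hfU
  map_zero := by simp

/-- The map `Tp : TU → TX` induced by a plot `p : U → X`, at the tangent vector `v` to `U` at `a`. -/
def plotTangent {n : ℕ} {U : Set (Euc n)} (hU : IsOpen U) {p : Euc n → X} (hp : IsPlotOn U p)
    {a : Euc n} (ha : a ∈ U) (v : Euc n) : Σ x : X, TangentSpaceAt x :=
  ⟨p a, (pointedAt hU hp ha).tangent v⟩

variable (X) in
/-- Hector's diffeology on `TX = ∐ₓ T_x X`: the one generated by the maps `Tp : TU = U × ℝⁿ → TX` for all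
plots `p : U → X`, that is, by the composites of these with smooth maps `(a, v) : ℝᵐ → U × ℝⁿ`. -/
@[reducible]
def hectorDiffeology : DiffeologicalSpace (Σ x : X, TangentSpaceAt x) :=
  DiffeologicalSpace.generateFrom
    {q | ∃ (n : ℕ) (U : Set (Euc n)) (hU : IsOpen U) (p : Euc n → X) (hp : IsPlotOn U p)
        (a v : Euc q.1 → Euc n) (ha : ∀ y, a y ∈ U),
        ContDiff ℝ ∞ a ∧ ContDiff ℝ ∞ v ∧ q.2 = fun y => plotTangent hU hp (ha y) (v y)}

variable (X) in
/-- The internal tangent bundle `T^dvs X → X`: the dvsification of Hector's diffeology. -/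
def tangentBundle : PseudoBundle.{u, u} X where
  Fibre x := TangentSpaceAt x
  diffeology := dvsification _ (hectorDiffeology X)
  isPseudoBundle := isPseudoBundle_dvsification <| by
    have h : hectorDiffeology X ≤ projDiffeology _ := by
      refine DiffeologicalSpace.generateFrom_le_iff_subset_toPlots.2 ?_
      rintro ⟨m, q⟩ ⟨n, U, hU, p, hp, a, v, ha, hac, -, h⟩
      dsimp only at a v ha hac h
      subst h
      exact hp m a hac ha
    exact fun n p hp => DiffeologicalSpace.le_iff'.1 h n p hp

end Tangent

/-! ### The axes with the gluing diffeology -/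

/-- The union of the coordinate axes in `ℝ²`. -/
def Axes : Type := {z : ℝ × ℝ // z.2 = 0 ∨ z.1 = 0}

/-- The inclusion of the first axis. -/
def xAxis (t : ℝ) : Axes := ⟨(t, 0), Or.inl rfl⟩

/-- The inclusion of the second axis. -/
def yAxis (t : ℝ) : Axes := ⟨(0, t), Or.inr rfl⟩

/-- The gluing diffeology: `X_g` is the quotient of `ℝ ⨿ ℝ` with the two origins identified. -/
instance : DiffeologicalSpace Axes := gluedDiffeology xAxis yAxis

/-- The fibre over `(x, y)` of `{(x, y, v) | y = 0} ∪ {(x, y, v) | x = 0, v = 0} ⊆ ℝ³`. -/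
def fibre₁ (z : Axes) : Submodule ℝ ℝ where
  carrier := {v | z.1.2 = 0 ∨ (z.1.1 = 0 ∧ v = 0)}
  add_mem' := by
    rintro a b (h | ⟨h, rfl⟩) (h' | ⟨h', rfl⟩)
    · exact Or.inl h
    · exact Or.inl h
    · exact Or.inl h'
    · exact Or.inr ⟨h, add_zero 0⟩
  zero_mem' := z.2.imp id fun h => ⟨h, rfl⟩
  smul_mem' := by
    rintro c a (h | ⟨h, rfl⟩)
    · exact Or.inl h
    · exact Or.inr ⟨h, smul_zero c⟩

/-- The fibre over `(x, y)` of `{(x, y, v) | y = 0, v = 0} ∪ {(x, y, v) | x = 0} ⊆ ℝ³`. -/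
def fibre₂ (z : Axes) : Submodule ℝ ℝ where
  carrier := {v | (z.1.2 = 0 ∧ v = 0) ∨ z.1.1 = 0}
  add_mem' := by
    rintro a b (⟨h, rfl⟩ | h) (⟨h', rfl⟩ | h')
    · exact Or.inl ⟨h, add_zero 0⟩
    · exact Or.inr h'
    · exact Or.inr h
    · exact Or.inr h
  zero_mem' := z.2.imp (fun h => ⟨h, rfl⟩) id
  smul_mem' := by
    rintro c a (⟨h, rfl⟩ | h)
    · exact Or.inl ⟨h, smul_zero c⟩
    · exact Or.inr h

/-- The piece `(ℝ × {0}) × ℝ` of `E₁`. -/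
def plane₁ (z : ℝ × ℝ) : Σ b, fibre₁ b := ⟨xAxis z.1, ⟨z.2, Or.inl rfl⟩⟩

/-- The piece `({0} × ℝ) × {0}` of `E₁`. -/
def line₁ (t : ℝ) : Σ b, fibre₁ b := ⟨yAxis t, 0⟩

/-- The piece `(ℝ × {0}) × {0}` of `E₂`. -/
def line₂ (t : ℝ) : Σ b, fibre₂ b := ⟨xAxis t, 0⟩

/-- The piece `({0} × ℝ) × ℝ` of `E₂`. -/
def plane₂ (z : ℝ × ℝ) : Σ b, fibre₂ b := ⟨yAxis z.1, ⟨z.2, Or.inr rfl⟩⟩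

/-- The diffeology of `E₁`, glued from a plane and a line at the origin. -/
@[reducible]
def diffeology₁ : DiffeologicalSpace (Σ b, fibre₁ b) :=
  letI := NormedSpace.toDiffeology (ℝ × ℝ)
  gluedDiffeology plane₁ line₁

/-- The diffeology of `E₂`, glued from a line and a plane at the origin. -/
@[reducible]
def diffeology₂ : DiffeologicalSpace (Σ b, fibre₂ b) :=
  letI := NormedSpace.toDiffeology (ℝ × ℝ)
  gluedDiffeology line₂ plane₂

lemma axes_surj (z : Axes) : (∃ x, xAxis x = z) ∨ ∃ y, yAxis y = z := by
  obtain ⟨⟨x, y⟩, h | h⟩ := z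
  · exact Or.inl ⟨x, Subtype.ext (Prod.ext rfl h.symm)⟩
  · exact Or.inr ⟨y, Subtype.ext (Prod.ext h.symm rfl)⟩

lemma ext₁ {e e' : Σ b, fibre₁ b} (h : e.1 = e'.1) (h' : (e.2 : ℝ) = e'.2) : e = e' := by
  obtain ⟨b, v⟩ := e
  obtain ⟨b', v'⟩ := e'
  obtain rfl : b = b' := h
  obtain rfl : v = v' := Subtype.ext h'
  rfl

lemma surj₁ (e : Σ b, fibre₁ b) : (∃ z, plane₁ z = e) ∨ ∃ t, line₁ t = e := by
  obtain ⟨b, v, h | ⟨h, hv⟩⟩ := e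
  · exact Or.inl ⟨(b.1.1, v), ext₁ (Subtype.ext (Prod.ext rfl h.symm)) rfl⟩
  · exact Or.inr ⟨b.1.2, ext₁ (Subtype.ext (Prod.ext h.symm rfl)) hv.symm⟩

lemma ext₂ {e e' : Σ b, fibre₂ b} (h : e.1 = e'.1) (h' : (e.2 : ℝ) = e'.2) : e = e' := by
  obtain ⟨b, v⟩ := e
  obtain ⟨b', v'⟩ := e'
  obtain rfl : b = b' := h
  obtain rfl : v = v' := Subtype.ext h'
  rfl

lemma surj₂ (e : Σ b, fibre₂ b) : (∃ t, line₂ t = e) ∨ ∃ z, plane₂ z = e := by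
  obtain ⟨b, v, ⟨h, hv⟩ | h⟩ := e
  · exact Or.inl ⟨b.1.1, ext₂ (Subtype.ext (Prod.ext rfl h.symm)) hv.symm⟩
  · exact Or.inr ⟨(b.1.2, v), ext₂ (Subtype.ext (Prod.ext h.symm rfl)) rfl⟩

section
attribute [local instance] NormedSpace.toDiffeology

lemma isPlotOn_pair {n : ℕ} {U : Set (Euc n)} {a c : Euc n → ℝ}
    (ha : IsPlotOn U a) (hc : IsPlotOn U c) :
    @IsPlotOn _ (NormedSpace.toDiffeology (ℝ × ℝ)) n U fun x => (a x, c x) :=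
  fun m f hf hU => ((ha m f hf hU).contDiff.prodMk (hc m f hf hU).contDiff :)

lemma isPlotOn_fst {n : ℕ} {U : Set (Euc n)} {a : Euc n → ℝ × ℝ}
    (ha : @IsPlotOn _ (NormedSpace.toDiffeology (ℝ × ℝ)) n U a) : IsPlotOn U fun x => (a x).1 :=
  fun m f hf hU => (contDiff_fst.comp (show ContDiff ℝ ∞ (a ∘ f) from ha m f hf hU) :)

lemma isPlotOn_snd {n : ℕ} {U : Set (Euc n)} {a : Euc n → ℝ × ℝ}
    (ha : @IsPlotOn _ (NormedSpace.toDiffeology (ℝ × ℝ)) n U a) : IsPlotOn U fun x => (a x).2 :=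
  fun m f hf hU => (contDiff_snd.comp (show ContDiff ℝ ∞ (a ∘ f) from ha m f hf hU) :)

lemma isPlotOn_add {n : ℕ} {U : Set (Euc n)} {a c : Euc n → ℝ}
    (ha : IsPlotOn U a) (hc : IsPlotOn U c) : IsPlotOn U fun x => a x + c x :=
  fun m f hf hU => (ContDiff.add (show ContDiff ℝ ∞ (a ∘ f) from ha m f hf hU)
    (show ContDiff ℝ ∞ (c ∘ f) from hc m f hf hU) :)

lemma isPlotOn_mul {n : ℕ} {U : Set (Euc n)} {a c : Euc n → ℝ}
    (ha : IsPlotOn U a) (hc : IsPlotOn U c) : IsPlotOn U fun x => a x * c x :=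
  fun m f hf hU => (ContDiff.mul (show ContDiff ℝ ∞ (a ∘ f) from ha m f hf hU)
    (show ContDiff ℝ ∞ (c ∘ f) from hc m f hf hU) :)

end

lemma isPlotOn_of_isPlot {X : Type u} [DiffeologicalSpace X] {n : ℕ} {U : Set (Euc n)}
    {p : Euc n → X} (hp : IsPlot p) : IsPlotOn U p :=
  fun _ _ hf _ => isPlot_reparam hp hf

lemma isPlot_xAxis : DSmooth xAxis := fun _ p hp =>
  DiffeologicalSpace.isPlot_generatedFrom_of_mem (Or.inl ⟨p, hp, rfl⟩)

lemma isPlot_yAxis : DSmooth yAxis := fun _ p hp =>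
  DiffeologicalSpace.isPlot_generatedFrom_of_mem (Or.inr ⟨p, hp, rfl⟩)

lemma isPseudoBundle₁ : IsPseudoBundle (fun b => fibre₁ b) diffeology₁ := by
  let := NormedSpace.toDiffeology (ℝ × ℝ)
  refine ⟨?_, fun n b s t hs ht => ?_, fun n r b s hr hs => ?_, fun n p hp => ?_⟩
  · have h : diffeology₁ ≤ projDiffeology _ :=
      gluedDiffeology_le (fun n a ha => isPlot_xAxis n (fun x => (a x).1)
        (contDiff_fst.comp (show ContDiff ℝ ∞ a from ha)).isPlot) isPlot_yAxis
    exact fun n p hp => DiffeologicalSpace.le_iff'.1 h n p hp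
  · refine (isPlot_glued_iff surj₁).2 fun x => ?_
    obtain ⟨V, hV, hxV, hs⟩ := (isPlot_glued_iff surj₁).1 hs x
    obtain ⟨W, hW, hxW, ht⟩ := (isPlot_glued_iff surj₁).1 ht x
    refine ⟨V ∩ W, hV.inter hW, ⟨hxV, hxW⟩, ?_⟩
    have hVW : V ∩ W ⊆ V := Set.inter_subset_left
    have hWV : V ∩ W ⊆ W := Set.inter_subset_right
    have val : ∀ {y} {e : Σ b, fibre₁ b} {c : fibre₁ (b y)},
        (⟨b y, c⟩ : Σ b, fibre₁ b) = e → b y = e.1 ∧ (c : ℝ) = e.2 := by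
      rintro y _ c rfl; exact ⟨rfl, rfl⟩
    rcases hs with ⟨a, ha, hsa⟩ | ⟨a, ha, hsa⟩ <;> rcases ht with ⟨c, hc, htc⟩ | ⟨c, hc, htc⟩
    · refine Or.inl ⟨fun y => ((a y).1, (a y).2 + (c y).2),
        isPlotOn_pair (isPlotOn_fst (ha.mono hVW))
          (isPlotOn_add (isPlotOn_snd (ha.mono hVW)) (isPlotOn_snd (hc.mono hWV))),
        fun y hy => ext₁ (val (hsa hy.1)).1 ?_⟩
      exact congrArg₂ (· + ·) (val (hsa hy.1)).2 (val (htc hy.2)).2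
    · refine Or.inl ⟨a, ha.mono hVW, fun y hy => ext₁ (val (hsa hy.1)).1 ?_⟩
      exact (congrArg₂ (· + ·) (val (hsa hy.1)).2 (val (htc hy.2)).2).trans (add_zero _)
    · refine Or.inl ⟨c, hc.mono hWV, fun y hy => ext₁ (val (htc hy.2)).1 ?_⟩
      exact (congrArg₂ (· + ·) (val (hsa hy.1)).2 (val (htc hy.2)).2).trans (zero_add _)
    · refine Or.inr ⟨a, ha.mono hVW, fun y hy => ext₁ (val (hsa hy.1)).1 ?_⟩
      exact (congrArg₂ (· + ·) (val (hsa hy.1)).2 (val (htc hy.2)).2).trans (add_zero _)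
  · refine (isPlot_glued_iff surj₁).2 fun x => ?_
    obtain ⟨V, hV, hxV, hs⟩ := (isPlot_glued_iff surj₁).1 hs x
    have val : ∀ {y} {e : Σ b, fibre₁ b} {c : fibre₁ (b y)},
        (⟨b y, c⟩ : Σ b, fibre₁ b) = e → b y = e.1 ∧ (c : ℝ) = e.2 := by
      rintro y _ c rfl; exact ⟨rfl, rfl⟩
    refine ⟨V, hV, hxV, ?_⟩
    rcases hs with ⟨a, ha, hsa⟩ | ⟨a, ha, hsa⟩
    · refine Or.inl ⟨fun y => ((a y).1, r y * (a y).2), isPlotOn_pair (isPlotOn_fst ha)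
        (isPlotOn_mul (isPlotOn_of_isPlot hr) (isPlotOn_snd ha)),
        fun y hy => ext₁ (val (hsa hy)).1 ?_⟩
      exact congrArg (r y * ·) (val (hsa hy)).2
    · refine Or.inr ⟨a, ha, fun y hy => ext₁ (val (hsa hy)).1 ?_⟩
      exact (congrArg (r y * ·) (val (hsa hy)).2).trans (mul_zero _)
  · refine (isPlot_glued_iff surj₁).2 fun x => ?_
    obtain ⟨V, hV, hxV, h⟩ := (isPlot_glued_iff axes_surj).1 hp x
    refine ⟨V, hV, hxV, ?_⟩
    rcases h with ⟨a, ha, h⟩ | ⟨a, ha, h⟩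
    · exact Or.inl ⟨fun y => (a y, 0), isPlotOn_pair ha (isPlotOn_of_isPlot isPlot_const),
        fun y hy => ext₁ (h hy) rfl⟩
    · exact Or.inr ⟨a, ha, fun y hy => ext₁ (h hy) rfl⟩

lemma isPseudoBundle₂ : IsPseudoBundle (fun b => fibre₂ b) diffeology₂ := by
  let := NormedSpace.toDiffeology (ℝ × ℝ)
  refine ⟨?_, fun n b s t hs ht => ?_, fun n r b s hr hs => ?_, fun n p hp => ?_⟩
  · have h : diffeology₂ ≤ projDiffeology _ :=
      gluedDiffeology_le isPlot_xAxis (fun n a ha => isPlot_yAxis n (fun x => (a x).1)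
        (contDiff_fst.comp (show ContDiff ℝ ∞ a from ha)).isPlot)
    exact fun n p hp => DiffeologicalSpace.le_iff'.1 h n p hp
  · refine (isPlot_glued_iff surj₂).2 fun x => ?_
    obtain ⟨V, hV, hxV, hs⟩ := (isPlot_glued_iff surj₂).1 hs x
    obtain ⟨W, hW, hxW, ht⟩ := (isPlot_glued_iff surj₂).1 ht x
    refine ⟨V ∩ W, hV.inter hW, ⟨hxV, hxW⟩, ?_⟩
    have hVW : V ∩ W ⊆ V := Set.inter_subset_left
    have hWV : V ∩ W ⊆ W := Set.inter_subset_right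
    have val : ∀ {y} {e : Σ b, fibre₂ b} {c : fibre₂ (b y)},
        (⟨b y, c⟩ : Σ b, fibre₂ b) = e → b y = e.1 ∧ (c : ℝ) = e.2 := by
      rintro y _ c rfl; exact ⟨rfl, rfl⟩
    rcases hs with ⟨a, ha, hsa⟩ | ⟨a, ha, hsa⟩ <;> rcases ht with ⟨c, hc, htc⟩ | ⟨c, hc, htc⟩
    · refine Or.inl ⟨a, ha.mono hVW, fun y hy => ext₂ (val (hsa hy.1)).1 ?_⟩
      exact (congrArg₂ (· + ·) (val (hsa hy.1)).2 (val (htc hy.2)).2).trans (add_zero _)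
    · refine Or.inr ⟨c, hc.mono hWV, fun y hy => ext₂ (val (htc hy.2)).1 ?_⟩
      exact (congrArg₂ (· + ·) (val (hsa hy.1)).2 (val (htc hy.2)).2).trans (zero_add _)
    · refine Or.inr ⟨a, ha.mono hVW, fun y hy => ext₂ (val (hsa hy.1)).1 ?_⟩
      exact (congrArg₂ (· + ·) (val (hsa hy.1)).2 (val (htc hy.2)).2).trans (add_zero _)
    · refine Or.inr ⟨fun y => ((a y).1, (a y).2 + (c y).2),
        isPlotOn_pair (isPlotOn_fst (ha.mono hVW))
          (isPlotOn_add (isPlotOn_snd (ha.mono hVW)) (isPlotOn_snd (hc.mono hWV))),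
        fun y hy => ext₂ (val (hsa hy.1)).1 ?_⟩
      exact congrArg₂ (· + ·) (val (hsa hy.1)).2 (val (htc hy.2)).2
  · refine (isPlot_glued_iff surj₂).2 fun x => ?_
    obtain ⟨V, hV, hxV, hs⟩ := (isPlot_glued_iff surj₂).1 hs x
    have val : ∀ {y} {e : Σ b, fibre₂ b} {c : fibre₂ (b y)},
        (⟨b y, c⟩ : Σ b, fibre₂ b) = e → b y = e.1 ∧ (c : ℝ) = e.2 := by
      rintro y _ c rfl; exact ⟨rfl, rfl⟩
    refine ⟨V, hV, hxV, ?_⟩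
    rcases hs with ⟨a, ha, hsa⟩ | ⟨a, ha, hsa⟩
    swap
    · refine Or.inr ⟨fun y => ((a y).1, r y * (a y).2), isPlotOn_pair (isPlotOn_fst ha)
        (isPlotOn_mul (isPlotOn_of_isPlot hr) (isPlotOn_snd ha)),
        fun y hy => ext₂ (val (hsa hy)).1 ?_⟩
      exact congrArg (r y * ·) (val (hsa hy)).2
    · refine Or.inl ⟨a, ha, fun y hy => ext₂ (val (hsa hy)).1 ?_⟩
      exact (congrArg (r y * ·) (val (hsa hy)).2).trans (mul_zero _)
  · refine (isPlot_glued_iff surj₂).2 fun x => ?_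
    obtain ⟨V, hV, hxV, h⟩ := (isPlot_glued_iff axes_surj).1 hp x
    refine ⟨V, hV, hxV, ?_⟩
    rcases h with ⟨a, ha, h⟩ | ⟨a, ha, h⟩
    swap
    · exact Or.inr ⟨fun y => (a y, 0), isPlotOn_pair ha (isPlotOn_of_isPlot isPlot_const),
        fun y hy => ext₂ (h hy) rfl⟩
    · exact Or.inl ⟨a, ha, fun y hy => ext₂ (h hy) rfl⟩

/-- The bundle `E₁` over `X_g`. -/
def E₁ : PseudoBundle Axes where
  Fibre b := fibre₁ b
  diffeology := diffeology₁
  isPseudoBundle := isPseudoBundle₁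

/-- The bundle `E₂` over `X_g`. -/
def E₂ : PseudoBundle Axes where
  Fibre b := fibre₂ b
  diffeology := diffeology₂
  isPseudoBundle := isPseudoBundle₂

end DiffBundle

end

namespace DiffBundle

universe u v w

/-! ### Pullback diffeologies and maps out of glued spaces and dvsifications -/

/-! A plot of the glued axes locally lifts to one of the two axes (`IsPlotOn.exists_axis`), so no
plot leaves the origin in a mixed direction. In the colimit a tangent vector depends only on the
germ of its plot, and a plot inside an axis factors through the standard line along that axis. Hence
each vector of `T_b X_g` is a multiple of an axis direction, the coefficient being the derivative of
the corresponding coordinate (`PointedPlot.tangent_eq_xLine`, `PointedPlot.tangent_eq_yLine`).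

Conversely the two coordinates are smooth functions on `X_g`, and by the chain rule a smooth
function has a differential on the colimit (`differentialAt`). The pair of differentials
`coordDifferential` distinguishes the two directions, and it is inverse to `axisTangent`.

Smoothness in both directions rests on the universal property `dSmooth_dvsification`: a fibrewise
linear map into a pseudo-bundle need only be tested before dvsification. For the tangent bundle this
leaves the maps `Tp`, which locally land in a single plane; for the direct sum it leaves the planes,
which are the tangent bundles of the axis plots, and the lines, which are zero sections. -/

/-- The largest diffeology on `X` that makes `f : X → Y` smooth. -/
@[reducible]
def pullbackDiffeology {X : Type u} {Y : Type v} [DiffeologicalSpace Y] (f : X → Y) :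
    DiffeologicalSpace X where
  plots n := {p | IsPlot (f ∘ p)}
  constant_plots _ := isPlot_const
  plot_reparam hp hf := isPlot_reparam hp hf
  locality {n p} hp := DiffeologicalSpace.locality (p := f ∘ p) fun x =>
    let ⟨U, hU, hx, h⟩ := hp x
    ⟨U, hU, hx, fun hf hf' => h hf hf'⟩

lemma IsPlot.congr {X : Type u} [DiffeologicalSpace X] {n : ℕ} {p q : Euc n → X}
    (hp : IsPlot p) (h : ∀ x, q x = p x) : IsPlot q :=
  (funext h : q = p) ▸ hp

lemma dSmooth_glued {X : Type u} {Y : Type v} {Z W : Type w}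
    [DiffeologicalSpace X] [DiffeologicalSpace Y] [DiffeologicalSpace W] {f : X → Z} {g : Y → Z}
    {F : Z → W} (hf : DSmooth (F ∘ f)) (hg : DSmooth (F ∘ g)) :
    @DSmooth _ _ (gluedDiffeology f g) _ F := by
  have h : gluedDiffeology f g ≤ pullbackDiffeology F :=
    gluedDiffeology_le (d := pullbackDiffeology F) hf hg
  exact fun n p hp => DiffeologicalSpace.le_iff'.1 h n p hp

lemma dSmooth_glued_left {X : Type u} {Y : Type v} {Z : Type w}
    [DiffeologicalSpace X] [DiffeologicalSpace Y] (f : X → Z) (g : Y → Z) :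
    @DSmooth _ _ _ (gluedDiffeology f g) f :=
  fun _ p hp => DiffeologicalSpace.isPlot_generatedFrom_of_mem (Or.inl ⟨p, hp, rfl⟩)

lemma dSmooth_glued_right {X : Type u} {Y : Type v} {Z : Type w}
    [DiffeologicalSpace X] [DiffeologicalSpace Y] (f : X → Z) (g : Y → Z) :
    @DSmooth _ _ _ (gluedDiffeology f g) g :=
  fun _ p hp => DiffeologicalSpace.isPlot_generatedFrom_of_mem (Or.inr ⟨p, hp, rfl⟩)

section

variable {B : Type u} [DiffeologicalSpace B] {E : B → Type v}
  [∀ b, AddCommGroup (E b)] [∀ b, Module ℝ (E b)]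

lemma le_dvsification (d : DiffeologicalSpace (Σ b, E b)) : d ≤ dvsification E d :=
  le_sInf fun _ h => h.1

/-- Each axiom is the same axiom in `F`: fibrewise linearity lets `φ` pass through sums, scalar
multiples and zero. -/
lemma isPseudoBundle_pullback (F : PseudoBundle.{u, w} B) (φ : ∀ b, E b →ₗ[ℝ] F.Fibre b) :
    IsPseudoBundle E
      (pullbackDiffeology fun e : Σ b, E b => (⟨e.1, φ e.1 e.2⟩ : Σ b, F.Fibre b)) where
  smooth_proj n p hp := F.isPseudoBundle.smooth_proj n _ hp
  smooth_add n b s t hs ht := by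
    have h := F.isPseudoBundle.smooth_add n b (fun x => φ _ (s x)) (fun x => φ _ (t x)) hs ht
    simp only [← map_add] at h
    exact h
  smooth_smul n r b s hr hs := by
    have h := F.isPseudoBundle.smooth_smul n r b (fun x => φ _ (s x)) hr hs
    simp only [← map_smul] at h
    exact h
  smooth_zero n p hp := by
    have h := F.isPseudoBundle.smooth_zero n p hp
    simp only [Function.comp_def, ← map_zero (φ _)] at h
    exact h

/-- A fibrewise linear map is smooth on the dvsification of `d` if it is smooth on `d`. -/
lemma dSmooth_dvsification {d : DiffeologicalSpace (Σ b, E b)} (F : PseudoBundle.{u, w} B)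
    (φ : ∀ b, E b →ₗ[ℝ] F.Fibre b)
    (h : d ≤ pullbackDiffeology fun e : Σ b, E b => (⟨e.1, φ e.1 e.2⟩ : Σ b, F.Fibre b)) :
    @DSmooth _ _ (dvsification E d) _
      (fun e : Σ b, E b => (⟨e.1, φ e.1 e.2⟩ : Σ b, F.Fibre b)) :=
  -- The pullback diffeology is one of those whose infimum is the dvsification.
  fun _ _ hp => DiffeologicalSpace.isPlot_sInf_iff.1 hp _ ⟨h, isPseudoBundle_pullback F φ⟩

lemma dSmooth_sumInl (E : PseudoBundle.{u, v} B) (F : PseudoBundle.{u, w} B) :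
    @DSmooth _ _ _ (directSum E F).diffeology (sumInl E F) := fun n p hp =>
  DiffeologicalSpace.le_iff'.1 (le_dvsification (E := fun b => E.Fibre b × F.Fibre b) _) n _
    (dSmooth_glued_left (sumInl E F) _ n p hp)

lemma dSmooth_sumInr (E : PseudoBundle.{u, v} B) (F : PseudoBundle.{u, w} B) :
    @DSmooth _ _ _ (directSum E F).diffeology (sumInr E F) := fun n p hp =>
  DiffeologicalSpace.le_iff'.1 (le_dvsification (E := fun b => E.Fibre b × F.Fibre b) _) n _
    (dSmooth_glued_right _ (sumInr E F) n p hp)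

end

/-! ### Differentials of smooth functions -/

section Differential

variable {X : Type u} [DiffeologicalSpace X]

/-- Plots on `U` are tested only by maps from a whole Euclidean space into `U`. Around each point a
ball in `U` is the diffeomorphic image of the whole space under `univBall`; there `f ∘ p` is smooth,
and composing with the smooth inverse carries this back to the ball. -/
lemma DSmooth.contDiffOn_comp {f : X → ℝ} (hf : DSmooth f) {n : ℕ} {U : Set (Euc n)}
    (hU : IsOpen U) {p : Euc n → X} (hp : IsPlotOn U p) : ContDiffOn ℝ ∞ (f ∘ p) U := by
  intro x hx
  obtain ⟨ε, hε, hεU⟩ := Metric.isOpen_iff.1 hU x hx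
  let h := OpenPartialHomeomorph.univBall x ε
  have ht : h.target = Metric.ball x ε := OpenPartialHomeomorph.univBall_target x hε
  have hmem : ∀ y, h y ∈ U := fun y => hεU <| ht ▸ h.map_source (by simp [h])
  have h1 : ContDiff ℝ ∞ (f ∘ p ∘ h) :=
    (hf _ _ (hp n h OpenPartialHomeomorph.contDiff_univBall hmem)).contDiff
  have h2 : ContDiffOn ℝ ∞ ((f ∘ p ∘ h) ∘ h.symm) (Metric.ball x ε) :=
    h1.comp_contDiffOn OpenPartialHomeomorph.contDiffOn_univBall_symm
  have h3 : ContDiffOn ℝ ∞ (f ∘ p) (Metric.ball x ε) := h2.congr fun y hy => by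
    simp only [Function.comp_apply]
    rw [h.right_inv (ht ▸ hy)]
  exact (h3.contDiffAt (Metric.ball_mem_nhds x hε)).contDiffWithinAt

lemma PointedPlot.differentiableAt_comp {f : X → ℝ} (hf : DSmooth f) {x : X} (p : PointedPlot x) :
    DifferentiableAt ℝ (f ∘ p.toFun) 0 :=
  ((DSmooth.contDiffOn_comp hf p.isOpen_dom p.isPlotOn).contDiffAt
    (p.isOpen_dom.mem_nhds p.zero_mem)).differentiableAt (by simp)

open scoped Classical in
/-- The differential `T_x X → ℝ` of a smooth function on a diffeological space. -/
noncomputable def differentialAt {f : X → ℝ} (hf : DSmooth f) (x : X) : TangentSpaceAt x →ₗ[ℝ] ℝ :=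
  (tangentRelations x).liftQ
    (DirectSum.toModule ℝ (PointedPlot x) ℝ fun p =>
      (fderiv ℝ (f ∘ p.toFun) 0 : Euc p.dim →ₗ[ℝ] ℝ))
    (Submodule.span_le.2 (by
      rintro _ ⟨p, q, g, v, hg, rfl⟩
      have hgd : DifferentiableAt ℝ g 0 :=
        (hg.contDiffOn.contDiffAt (p.isOpen_dom.mem_nhds p.zero_mem)).differentiableAt (by simp)
      have hq : DifferentiableAt ℝ (f ∘ q.toFun) (g 0) := by
        rw [hg.map_zero]; exact q.differentiableAt_comp hf
      -- The morphism relates the two plots only on the domain of `p`, but this fixes the germ at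
      -- `0`; the chain rule then kills the relation.
      have he : f ∘ p.toFun =ᶠ[nhds 0] (f ∘ q.toFun) ∘ g :=
        Filter.eventuallyEq_of_mem (p.isOpen_dom.mem_nhds p.zero_mem)
          fun y hy => congrArg f (hg.comp_eq hy).symm
      simp [DirectSum.toModule_lof, he.fderiv_eq, fderiv_comp 0 hq hgd, hg.map_zero]))

lemma differentialAt_tangent {f : X → ℝ} (hf : DSmooth f) {x : X} (p : PointedPlot x)
    (v : Euc p.dim) : differentialAt hf x (p.tangent v) = fderiv ℝ (f ∘ p.toFun) 0 v := by
  classical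
  exact DirectSum.toModule_lof (M := fun p : PointedPlot x => Euc p.dim)
    (φ := fun p => (fderiv ℝ (f ∘ p.toFun) 0 : Euc p.dim →ₗ[ℝ] ℝ)) ℝ p v

lemma TangentSpaceAt.hom_ext {x : X} {M : Type*} [AddCommGroup M] [Module ℝ M]
    {φ ψ : TangentSpaceAt x →ₗ[ℝ] M} (h : ∀ (p : PointedPlot x) v,
      φ (p.tangent v) = ψ (p.tangent v)) : φ = ψ := by
  classical
  refine Submodule.linearMap_qext _ (DirectSum.linearMap_ext ℝ fun p => LinearMap.ext fun v => ?_)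
  exact h p v

lemma PointedPlot.IsMorphism.tangent_eq {x : X} {p q : PointedPlot x} {f : Euc p.dim → Euc q.dim}
    (hf : p.IsMorphism q f) (v : Euc p.dim) : p.tangent v = q.tangent (fderiv ℝ f 0 v) :=
  (Submodule.Quotient.eq _).2 (Submodule.subset_span ⟨p, q, f, v, hf, rfl⟩)

/-- `pointedAt` translates `a` to the origin, and derivatives are invariant under translation. -/
lemma differentialAt_plotTangent {f : X → ℝ} (hf : DSmooth f) {n : ℕ} {U : Set (Euc n)}
    (hU : IsOpen U) {p : Euc n → X} (hp : IsPlotOn U p) {a : Euc n} (ha : a ∈ U) (v : Euc n) :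
    differentialAt hf (p a) (plotTangent hU hp ha v).2 = fderiv ℝ (f ∘ p) a v := by
  refine (differentialAt_tangent hf (pointedAt hU hp ha) v).trans ?_
  have := fderiv_comp_add_left (𝕜 := ℝ) (f := f ∘ p) (x := 0) a
  rw [add_zero] at this
  exact congrArg (fun L => L v) this

/-- The restriction of a pointed plot to a smaller neighbourhood of `0`. -/
noncomputable def PointedPlot.restrict {x : X} (p : PointedPlot x) {V : Set (Euc p.dim)}
    (hV : IsOpen V) (h0 : 0 ∈ V) (hVp : V ⊆ p.dom) : PointedPlot x where
  dim := p.dim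
  dom := V
  isOpen_dom := hV
  zero_mem := h0
  toFun := p.toFun
  isPlotOn := p.isPlotOn.mono hVp
  map_zero := p.map_zero

/-- The inclusion of `V` is a morphism whose derivative is the identity. Tangent vectors can
therefore be computed on arbitrarily small neighbourhoods of `0`. -/
lemma PointedPlot.tangent_restrict {x : X} (p : PointedPlot x) {V : Set (Euc p.dim)}
    (hV : IsOpen V) (h0 : 0 ∈ V) (hVp : V ⊆ p.dom) (v : Euc p.dim) :
    (p.restrict hV h0 hVp).tangent v = p.tangent v := by
  have h : (p.restrict hV h0 hVp).IsMorphism p id := ⟨contDiffOn_id, hVp, rfl, fun _ _ => rfl⟩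
  have hd : fderiv ℝ (id : Euc p.dim → Euc p.dim) 0 v = v := by simp
  exact (h.tangent_eq v).trans (congrArg p.tangent hd)

end Differential

/-! ### Coordinates on the axes -/

/-- The first coordinate on the axes. -/
def xCoord (z : Axes) : ℝ := z.1.1

/-- The second coordinate on the axes. -/
def yCoord (z : Axes) : ℝ := z.1.2

/-- The coordinate is the identity on one axis and zero on the other. -/
lemma dSmooth_fst : DSmooth xCoord :=
  dSmooth_glued (fun _ _ hp => hp) fun _ _ _ => isPlot_const (x := (0 : ℝ))

lemma dSmooth_snd : DSmooth yCoord :=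
  dSmooth_glued (fun _ _ _ => isPlot_const (x := (0 : ℝ))) fun _ _ hp => hp

lemma xAxis_fst {z : Axes} (h : z.1.2 = 0) : xAxis z.1.1 = z :=
  Subtype.ext (Prod.ext rfl h.symm)

lemma yAxis_snd {z : Axes} (h : z.1.1 = 0) : yAxis z.1.2 = z :=
  Subtype.ext (Prod.ext h.symm rfl)

/-- A plot of the axes locally takes values in one of them. -/
lemma IsPlotOn.exists_axis {n : ℕ} {U : Set (Euc n)} (hU : IsOpen U) {p : Euc n → Axes}
    (hp : IsPlotOn U p) {x : Euc n} (hx : x ∈ U) : ∃ V, IsOpen V ∧ x ∈ V ∧ V ⊆ U ∧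
      ((∀ y ∈ V, (p y).1.2 = 0) ∨ ∀ y ∈ V, (p y).1.1 = 0) := by
  obtain ⟨ε, hε, hεU⟩ := Metric.isOpen_iff.1 hU x hx
  let h := OpenPartialHomeomorph.univBall x ε
  have ht : h.target = Metric.ball x ε := OpenPartialHomeomorph.univBall_target x hε
  have hmem : ∀ y, h y ∈ U := fun y => hεU <| ht ▸ h.map_source (by simp [h])
  -- Reparametrising by the ball turns `p` into a plot on the whole space, to which the local
  -- lifting criterion applies; the neighbourhood found there is transported back by `h.symm`.
  obtain ⟨W, hW, hxW, hl⟩ := (isPlot_glued_iff axes_surj).1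
    (hp n h OpenPartialHomeomorph.contDiff_univBall hmem) (h.symm x)
  have hr : ∀ y ∈ h.target, h (h.symm y) = y := fun y hy => h.right_inv hy
  refine ⟨h.target ∩ h.symm ⁻¹' W, h.symm.isOpen_inter_preimage hW,
    ⟨ht ▸ Metric.mem_ball_self hε, hxW⟩, fun y hy => hεU (ht ▸ hy.1), ?_⟩
  refine hl.imp ?_ ?_ <;> rintro ⟨a, -, ha⟩ y ⟨hy, hyW⟩ <;>
  · have := ha hyW
    simp only [Function.comp_apply, hr y hy] at this
    rw [this]
    rfl

/-! ### The tangent spaces of the axes -/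

/-- Only points off the first axis need an argument: a plot through such a point stays locally in
the second axis, where the first coordinate vanishes identically. -/
lemma differentialAt_fst_mem (b : Axes) (ξ : TangentSpaceAt b) :
    differentialAt dSmooth_fst b ξ ∈ fibre₁ b := by
  by_cases hb : b.1.2 = 0
  · exact Or.inl hb
  refine Or.inr ⟨b.2.resolve_left hb, ?_⟩
  suffices h : differentialAt dSmooth_fst b = 0 from LinearMap.congr_fun h ξ
  refine TangentSpaceAt.hom_ext fun p v => ?_
  obtain ⟨V, hV, h0, -, h | h⟩ := p.isPlotOn.exists_axis p.isOpen_dom p.zero_mem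
  · exact absurd (p.map_zero ▸ h 0 h0) hb
  · have he : xCoord ∘ p.toFun =ᶠ[nhds 0] fun _ => 0 :=
      Filter.eventuallyEq_of_mem (hV.mem_nhds h0) h
    simp [differentialAt_tangent, he.fderiv_eq]

lemma differentialAt_snd_mem (b : Axes) (ξ : TangentSpaceAt b) :
    differentialAt dSmooth_snd b ξ ∈ fibre₂ b := by
  by_cases hb : b.1.1 = 0
  · exact Or.inr hb
  refine Or.inl ⟨b.2.resolve_right hb, ?_⟩
  suffices h : differentialAt dSmooth_snd b = 0 from LinearMap.congr_fun h ξ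
  refine TangentSpaceAt.hom_ext fun p v => ?_
  obtain ⟨V, hV, h0, -, h | h⟩ := p.isPlotOn.exists_axis p.isOpen_dom p.zero_mem
  · have he : yCoord ∘ p.toFun =ᶠ[nhds 0] fun _ => 0 :=
      Filter.eventuallyEq_of_mem (hV.mem_nhds h0) h
    simp [differentialAt_tangent, he.fderiv_eq]
  · exact absurd (p.map_zero ▸ h 0 h0) hb

/-- The differentials of the two coordinates, as a map `T_b X_g → E₁ ⊕ E₂`. -/
noncomputable def coordDifferential (b : Axes) : TangentSpaceAt b →ₗ[ℝ] fibre₁ b × fibre₂ b :=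
  ((differentialAt dSmooth_fst b).codRestrict _ (differentialAt_fst_mem b)).prod
    ((differentialAt dSmooth_snd b).codRestrict _ (differentialAt_snd_mem b))

open scoped Classical in
/-- The first axis as a plot pointed at `b` (constant if `b` is not on that axis). -/
noncomputable def xLine (b : Axes) : PointedPlot b where
  dim := 1
  dom := Set.univ
  isOpen_dom := isOpen_univ
  zero_mem := trivial
  -- The constant value off the axis is harmless, since `fibre₁ b` is zero there.
  toFun t := if b.1.2 = 0 then xAxis (b.1.1 + t 0) else b
  isPlotOn := isPlotOn_of_isPlot <| by
    split_ifs
    · exact isPlot_xAxis 1 (fun t => b.1.1 + t 0)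
        (show ContDiff ℝ ∞ fun t : Euc 1 => b.1.1 + t 0 by fun_prop).isPlot
    · exact isPlot_const
  map_zero := by
    split_ifs with h
    · simpa using xAxis_fst h
    · rfl

open scoped Classical in
/-- The second axis as a plot pointed at `b` (constant if `b` is not on that axis). -/
noncomputable def yLine (b : Axes) : PointedPlot b where
  dim := 1
  dom := Set.univ
  isOpen_dom := isOpen_univ
  zero_mem := trivial
  toFun t := if b.1.1 = 0 then yAxis (b.1.2 + t 0) else b
  isPlotOn := isPlotOn_of_isPlot <| by
    split_ifs
    · exact isPlot_yAxis 1 (fun t => b.1.2 + t 0)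
        (show ContDiff ℝ ∞ fun t : Euc 1 => b.1.2 + t 0 by fun_prop).isPlot
    · exact isPlot_const
  map_zero := by
    split_ifs with h
    · simpa using yAxis_snd h
    · rfl


/-- The basis vector of `ℝ¹`. -/
noncomputable abbrev unitVec : Euc 1 := EuclideanSpace.single 0 1

lemma xLine_fst {b : Axes} (h : b.1.2 = 0) (t : Euc 1) :
    xCoord ((xLine b).toFun t) = xCoord b + t 0 := by
  simp [xLine, h, xAxis, xCoord]

lemma xLine_snd (b : Axes) (t : Euc 1) : yCoord ((xLine b).toFun t) = yCoord b := by
  by_cases h : b.1.2 = 0 <;> simp [xLine, h, xAxis, yCoord]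

lemma yLine_fst (b : Axes) (t : Euc 1) : xCoord ((yLine b).toFun t) = xCoord b := by
  by_cases h : b.1.1 = 0 <;> simp [yLine, h, yAxis, xCoord]

lemma yLine_snd {b : Axes} (h : b.1.1 = 0) (t : Euc 1) :
    yCoord ((yLine b).toFun t) = yCoord b + t 0 := by
  simp [yLine, h, yAxis, yCoord]

lemma fderiv_const_add_coord (c : ℝ) (a v : Euc 1) :
    fderiv ℝ (fun t : Euc 1 => c + t 0) a v = v 0 := by
  rw [fderiv_const_add]
  exact congrArg (fun L => L v) (EuclideanSpace.proj (𝕜 := ℝ) (0 : Fin 1)).fderiv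

lemma fderiv_zero_apply (a v : Euc 1) : fderiv ℝ (fun _ : Euc 1 => (0 : ℝ)) a v = 0 := by simp

/-- The multiples of the direction of the first axis in `T_b X_g`. -/
noncomputable def xTangent (b : Axes) : ℝ →ₗ[ℝ] TangentSpaceAt b :=
  (xLine b).tangent ∘ₗ LinearMap.toSpanSingleton ℝ (Euc 1) unitVec

/-- The multiples of the direction of the second axis in `T_b X_g`. -/
noncomputable def yTangent (b : Axes) : ℝ →ₗ[ℝ] TangentSpaceAt b :=
  (yLine b).tangent ∘ₗ LinearMap.toSpanSingleton ℝ (Euc 1) unitVec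

/-- The function `F` allows differentiating an explicit formula instead of a composite with the case
distinction in `xLine`. -/
lemma differentialAt_xTangent {f : Axes → ℝ} (hf : DSmooth f) (b : Axes) (r : ℝ) {F : Euc 1 → ℝ}
    (hF : ∀ t, f ((xLine b).toFun t) = F t) :
    differentialAt hf b (xTangent b r) = fderiv ℝ F 0 (r • unitVec) := by
  obtain rfl : f ∘ (xLine b).toFun = F := funext hF
  exact differentialAt_tangent hf (xLine b) _

lemma differentialAt_yTangent {f : Axes → ℝ} (hf : DSmooth f) (b : Axes) (r : ℝ) {F : Euc 1 → ℝ}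
    (hF : ∀ t, f ((yLine b).toFun t) = F t) :
    differentialAt hf b (yTangent b r) = fderiv ℝ F 0 (r • unitVec) := by
  obtain rfl : f ∘ (yLine b).toFun = F := funext hF
  exact differentialAt_tangent hf (yLine b) _

/-- The sum of the axis directions, as a map `E₁ ⊕ E₂ → T_b X_g`. -/
noncomputable def axisTangent (b : Axes) : fibre₁ b × fibre₂ b →ₗ[ℝ] TangentSpaceAt b :=
  (xTangent b ∘ₗ (fibre₁ b).subtype).coprod (yTangent b ∘ₗ (fibre₂ b).subtype)

lemma axisTangent_apply (b : Axes) (e : fibre₁ b × fibre₂ b) :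
    axisTangent b e = xTangent b e.1 + yTangent b e.2 := rfl

/-- The first coordinate is constant along `yLine`, so that summand contributes nothing. Along
`xLine` it has slope one if `b` is on the first axis; otherwise the component in `fibre₁ b` is zero.
-/
lemma differentialAt_fst_axisTangent (b : Axes) (e : fibre₁ b × fibre₂ b) :
    differentialAt dSmooth_fst b (axisTangent b e) = e.1 := by
  rw [axisTangent_apply, map_add, differentialAt_yTangent _ _ _
    (F := fun _ : Euc 1 => xCoord b) (yLine_fst b)]
  obtain ⟨⟨v, h | ⟨h, rfl⟩⟩, w⟩ := e
  · rw [differentialAt_xTangent _ _ _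
      (F := fun t : Euc 1 => xCoord b + t 0) (xLine_fst h), fderiv_const_add_coord]
    simp
  · simp

lemma differentialAt_snd_axisTangent (b : Axes) (e : fibre₁ b × fibre₂ b) :
    differentialAt dSmooth_snd b (axisTangent b e) = e.2 := by
  rw [axisTangent_apply, map_add, differentialAt_xTangent _ _ _
    (F := fun _ : Euc 1 => yCoord b) (xLine_snd b)]
  obtain ⟨v, ⟨w, ⟨h, rfl⟩ | h⟩⟩ := e
  · simp
  · rw [differentialAt_yTangent _ _ _
      (F := fun t : Euc 1 => yCoord b + t 0) (yLine_snd h), fderiv_const_add_coord]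
    simp

lemma coordDifferential_axisTangent (b : Axes) (e : fibre₁ b × fibre₂ b) :
    coordDifferential b (axisTangent b e) = e :=
  Prod.ext (Subtype.ext (differentialAt_fst_axisTangent b e))
    (Subtype.ext (differentialAt_snd_axisTangent b e))

/-- On `V` the plot factors through `xLine b` by way of its first coordinate, so a defining relation
of the colimit pushes the vector forward to the line. -/
lemma PointedPlot.tangent_eq_xLine {b : Axes} (p : PointedPlot b) {V : Set (Euc p.dim)}
    (hV : IsOpen V) (h0 : 0 ∈ V) (hVp : V ⊆ p.dom) (h : ∀ y ∈ V, (p.toFun y).1.2 = 0)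
    (v : Euc p.dim) : p.tangent v =
      xTangent b (fderiv ℝ (xCoord ∘ p.toFun) 0 v) := by
  -- The shift by `xCoord b` is needed because `xLine b` passes through `b` at parameter `0`.
  let g : Euc p.dim → Euc 1 := fun y => (xCoord (p.toFun y) - xCoord b) • unitVec
  have hp := p.map_zero
  have hb : b.1.2 = 0 := hp ▸ h 0 h0
  have hc : ContDiffOn ℝ ∞ (fun y => xCoord (p.toFun y)) V :=
    (DSmooth.contDiffOn_comp dSmooth_fst p.isOpen_dom p.isPlotOn).mono hVp
  have hg : (p.restrict hV h0 hVp).IsMorphism (xLine b) g := by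
    refine ⟨(hc.sub contDiffOn_const).smul contDiffOn_const, fun _ _ => trivial, ?_,
      fun y hy => Subtype.ext (Prod.ext ?_ ?_)⟩
    · change (xCoord (p.toFun 0) - xCoord b) • unitVec = 0
      rw [hp, sub_self, zero_smul]
    · refine (xLine_fst hb _).trans ?_
      change xCoord b + (xCoord (p.toFun y) - xCoord b) * 1 = xCoord (p.toFun y)
      ring
    · exact (xLine_snd b _).trans (hb.trans (h y hy).symm)
  have hd : fderiv ℝ g 0 v = fderiv ℝ (xCoord ∘ p.toFun) 0 v • unitVec := by
    have hd0 : DifferentiableAt ℝ (fun y => xCoord (p.toFun y)) 0 :=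
      p.differentiableAt_comp dSmooth_fst
    simp only [g]
    rw [fderiv_smul_const (hd0.sub_const _), fderiv_sub_const]
    rfl
  rw [← p.tangent_restrict hV h0 hVp]
  exact (hg.tangent_eq v).trans (congrArg (xLine b).tangent hd)

lemma PointedPlot.tangent_eq_yLine {b : Axes} (p : PointedPlot b) {V : Set (Euc p.dim)}
    (hV : IsOpen V) (h0 : 0 ∈ V) (hVp : V ⊆ p.dom) (h : ∀ y ∈ V, (p.toFun y).1.1 = 0)
    (v : Euc p.dim) : p.tangent v =
      yTangent b (fderiv ℝ (yCoord ∘ p.toFun) 0 v) := by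
  let g : Euc p.dim → Euc 1 := fun y => (yCoord (p.toFun y) - yCoord b) • unitVec
  have hp := p.map_zero
  have hb : b.1.1 = 0 := hp ▸ h 0 h0
  have hc : ContDiffOn ℝ ∞ (fun y => yCoord (p.toFun y)) V :=
    (DSmooth.contDiffOn_comp dSmooth_snd p.isOpen_dom p.isPlotOn).mono hVp
  have hg : (p.restrict hV h0 hVp).IsMorphism (yLine b) g := by
    refine ⟨(hc.sub contDiffOn_const).smul contDiffOn_const, fun _ _ => trivial, ?_,
      fun y hy => Subtype.ext (Prod.ext ?_ ?_)⟩
    · change (yCoord (p.toFun 0) - yCoord b) • unitVec = 0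
      rw [hp, sub_self, zero_smul]
    · exact (yLine_fst b _).trans (hb.trans (h y hy).symm)
    · refine (yLine_snd hb _).trans ?_
      change yCoord b + (yCoord (p.toFun y) - yCoord b) * 1 = yCoord (p.toFun y)
      ring
  have hd : fderiv ℝ g 0 v = fderiv ℝ (yCoord ∘ p.toFun) 0 v • unitVec := by
    have hd0 : DifferentiableAt ℝ (fun y => yCoord (p.toFun y)) 0 :=
      p.differentiableAt_comp dSmooth_snd
    simp only [g]
    rw [fderiv_smul_const (hd0.sub_const _), fderiv_sub_const]
    rfl
  rw [← p.tangent_restrict hV h0 hVp]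
  exact (hg.tangent_eq v).trans (congrArg (yLine b).tangent hd)

/-- It suffices to test vectors of pointed plots. Near `0` such a plot stays in one axis: the other
coordinate has zero differential, and the remaining term is the vector itself. -/
lemma axisTangent_coordDifferential (b : Axes) (ξ : TangentSpaceAt b) :
    axisTangent b (coordDifferential b ξ) = ξ := by
  suffices h : axisTangent b ∘ₗ coordDifferential b = LinearMap.id from LinearMap.congr_fun h ξ
  refine TangentSpaceAt.hom_ext fun p v => ?_
  change xTangent b (differentialAt dSmooth_fst b (p.tangent v)) +
      yTangent b (differentialAt dSmooth_snd b (p.tangent v)) = p.tangent v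
  rw [differentialAt_tangent, differentialAt_tangent]
  obtain ⟨V, hV, h0, hVp, h | h⟩ := p.isPlotOn.exists_axis p.isOpen_dom p.zero_mem
  · have he : yCoord ∘ p.toFun =ᶠ[nhds 0] fun _ => 0 :=
      Filter.eventuallyEq_of_mem (hV.mem_nhds h0) h
    rw [p.tangent_eq_xLine hV h0 hVp h, he.fderiv_eq]
    simp
  · have he : xCoord ∘ p.toFun =ᶠ[nhds 0] fun _ => 0 :=
      Filter.eventuallyEq_of_mem (hV.mem_nhds h0) h
    rw [p.tangent_eq_yLine hV h0 hVp h, he.fderiv_eq]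
    simp

/-! ### Smoothness of the two maps -/

lemma sum_ext {e e' : Σ b, fibre₁ b × fibre₂ b} (h : e.1 = e'.1) (h₁ : (e.2.1 : ℝ) = e'.2.1)
    (h₂ : (e.2.2 : ℝ) = e'.2.2) : e = e' := by
  obtain ⟨b, v, w⟩ := e
  obtain ⟨b', v', w'⟩ := e'
  obtain rfl : b = b' := h
  obtain rfl : v = v' := Subtype.ext h₁
  obtain rfl : w = w' := Subtype.ext h₂
  rfl

/-- As `coordDifferential` has a left inverse, tangent vectors given by different pointed plots can
be compared through their two differentials. -/
lemma tangent_ext {e e' : Σ b : Axes, TangentSpaceAt b} (h : e.1 = e'.1)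
    (h₁ : differentialAt dSmooth_fst e.1 e.2 = differentialAt dSmooth_fst e'.1 e'.2)
    (h₂ : differentialAt dSmooth_snd e.1 e.2 = differentialAt dSmooth_snd e'.1 e'.2) : e = e' := by
  obtain ⟨b, ξ⟩ := e
  obtain ⟨b', ξ'⟩ := e'
  obtain rfl : b = b' := h
  obtain rfl : ξ = ξ' := by
    rw [← axisTangent_coordDifferential b ξ, ← axisTangent_coordDifferential b ξ']
    exact congrArg _ (Prod.ext (Subtype.ext h₁) (Subtype.ext h₂))
  rfl

lemma isPlot_plane₁ {n : ℕ} {c w : Euc n → ℝ} (hc : ContDiff ℝ ∞ c) (hw : ContDiff ℝ ∞ w) :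
    @IsPlot _ diffeology₁ n fun y => plane₁ (c y, w y) := by
  let := NormedSpace.toDiffeology (ℝ × ℝ)
  exact dSmooth_glued_left plane₁ line₁ n (fun y => (c y, w y)) (hc.prodMk hw)

lemma isPlot_plane₂ {n : ℕ} {c w : Euc n → ℝ} (hc : ContDiff ℝ ∞ c) (hw : ContDiff ℝ ∞ w) :
    @IsPlot _ diffeology₂ n fun y => plane₂ (c y, w y) := by
  let := NormedSpace.toDiffeology (ℝ × ℝ)
  exact dSmooth_glued_right line₂ plane₂ n (fun y => (c y, w y)) (hc.prodMk hw)

lemma contDiff_fderiv_comp {n m : ℕ} {U : Set (Euc n)} (hU : IsOpen U) {F : Euc n → ℝ}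
    (hF : ContDiffOn ℝ ∞ F U) {a v : Euc m → Euc n} (ha : ContDiff ℝ ∞ a) (hv : ContDiff ℝ ∞ v)
    (haU : ∀ y, a y ∈ U) : ContDiff ℝ ∞ fun y => fderiv ℝ F (a y) (v y) :=
  ((hF.fderiv_of_isOpen hU (m := ∞) (by simp)).comp_contDiff ha haU).clm_apply hv

/-- On a generator `Tp`, with `p` locally inside one axis, the image lies in the plane of the
corresponding summand. Its base coordinate is that of `p` and its fibre coordinate is the
derivative, both smooth. -/
lemma dSmooth_coordDifferential :
    @DSmooth _ _ (tangentBundle Axes).diffeology (directSum E₁ E₂).diffeology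
      (fun e => ⟨e.1, coordDifferential e.1 e.2⟩) := by
  refine dSmooth_dvsification (directSum E₁ E₂) coordDifferential ?_
  refine DiffeologicalSpace.generateFrom_le_iff_subset_toPlots.2 ?_
  rintro ⟨m, q⟩ ⟨n, U, hU, p, hp, a, v, ha, hac, hvc, h⟩
  dsimp only at a v ha hac hvc h
  subst h
  refine (directSum E₁ E₂).diffeology.locality fun y₀ => ?_
  obtain ⟨V, hV, hyV, hVU, h⟩ := hp.exists_axis hU (ha y₀)
  have hX := (DSmooth.contDiffOn_comp dSmooth_fst hU hp).mono hVU
  have hY := (DSmooth.contDiffOn_comp dSmooth_snd hU hp).mono hVU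
  refine ⟨a ⁻¹' V, hV.preimage hac.continuous, hyV, fun {k f} hfV hf => ?_⟩
  have haf := hac.comp hf
  have hvf := hvc.comp hf
  rcases h with h | h
  -- The second coordinate vanishes on the open set `V`, not just at the point, so its derivative
  -- vanishes too.
  · have hd : ∀ y, fderiv ℝ (yCoord ∘ p) (a (f y)) (v (f y)) = 0 := fun y => by
      have he : yCoord ∘ p =ᶠ[nhds (a (f y))] fun _ => 0 :=
        Filter.eventuallyEq_of_mem (hV.mem_nhds (hfV y)) h
      simp [he.fderiv_eq]
    refine IsPlot.congr (dSmooth_sumInl E₁ E₂ k _ (isPlot_plane₁ (hX.comp_contDiff haf hfV)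
      (contDiff_fderiv_comp hV hX haf hvf hfV))) fun y => ?_
    refine sum_ext (Subtype.ext (Prod.ext rfl (h _ (hfV y)))) ?_ ?_
    · exact differentialAt_plotTangent dSmooth_fst hU hp (ha (f y)) (v (f y))
    · exact (differentialAt_plotTangent dSmooth_snd hU hp (ha (f y)) (v (f y))).trans (hd y)
  · have hd : ∀ y, fderiv ℝ (xCoord ∘ p) (a (f y)) (v (f y)) = 0 := fun y => by
      have he : xCoord ∘ p =ᶠ[nhds (a (f y))] fun _ => 0 :=
        Filter.eventuallyEq_of_mem (hV.mem_nhds (hfV y)) h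
      simp [he.fderiv_eq]
    refine IsPlot.congr (dSmooth_sumInr E₁ E₂ k _ (isPlot_plane₂ (hY.comp_contDiff haf hfV)
      (contDiff_fderiv_comp hV hY haf hvf hfV))) fun y => ?_
    refine sum_ext (Subtype.ext (Prod.ext (h _ (hfV y)) rfl)) ?_ ?_
    · exact (differentialAt_plotTangent dSmooth_fst hU hp (ha (f y)) (v (f y))).trans (hd y)
    · exact differentialAt_plotTangent dSmooth_snd hU hp (ha (f y)) (v (f y))

/-- A smooth vector field along a plot `U → X` is a plot of the tangent bundle. -/
lemma isPlot_plotTangent {X : Type u} [DiffeologicalSpace X] {n m : ℕ} {U : Set (Euc n)}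
    (hU : IsOpen U) {p : Euc n → X} (hp : IsPlotOn U p) {a v : Euc m → Euc n} (ha : ∀ y, a y ∈ U)
    (hac : ContDiff ℝ ∞ a) (hvc : ContDiff ℝ ∞ v) :
    @IsPlot _ (tangentBundle X).diffeology m fun y => plotTangent hU hp (ha y) (v y) :=
  DiffeologicalSpace.le_iff'.1 (le_dvsification (E := fun x : X => TangentSpaceAt x) _) m _
    (DiffeologicalSpace.isPlot_generatedFrom_of_mem ⟨n, U, hU, p, hp, a, v, ha, hac, hvc, rfl⟩)

/-- `axisTangent` as a map of total spaces. -/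
noncomputable def axisTangentTotal (e : Σ b, fibre₁ b × fibre₂ b) :
    Σ b, (tangentBundle Axes).Fibre b := ⟨e.1, axisTangent e.1 e.2⟩

lemma isPlotOn_xAxis : IsPlotOn Set.univ fun t : Euc 1 => xAxis (t 0) :=
  isPlotOn_of_isPlot <| isPlot_xAxis 1 (fun t => t 0)
    (show ContDiff ℝ ∞ fun t : Euc 1 => t 0 by fun_prop).isPlot

lemma isPlotOn_yAxis : IsPlotOn Set.univ fun t : Euc 1 => yAxis (t 0) :=
  isPlotOn_of_isPlot <| isPlot_yAxis 1 (fun t => t 0)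
    (show ContDiff ℝ ∞ fun t : Euc 1 => t 0 by fun_prop).isPlot

lemma fderiv_coord (a v : Euc 1) : fderiv ℝ (fun t : Euc 1 => t 0) a v = v 0 :=
  congrArg (fun L => L v) (EuclideanSpace.proj (𝕜 := ℝ) (0 : Fin 1)).fderiv

/-- A point `(c, w)` of the plane goes to the vector `w` at `c` of the axis plot, so a plot of the
plane goes to a generator of the tangent diffeology. The line goes to the zero section, which is
smooth in any pseudo-bundle. -/
lemma dSmooth_axisTangent_inl :
    @DSmooth _ _ diffeology₁ _ (axisTangentTotal ∘ sumInl E₁ E₂) := by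
  let := NormedSpace.toDiffeology (ℝ × ℝ)
  refine dSmooth_glued (fun n q hq => ?_) fun n q hq => ?_
  · have hq : ContDiff ℝ ∞ q := hq
    refine IsPlot.congr (isPlot_plotTangent isOpen_univ isPlotOn_xAxis (fun _ => trivial)
      (a := fun y => (q y).1 • unitVec) (v := fun y => (q y).2 • unitVec)
      (hq.fst.smul contDiff_const) (hq.snd.smul contDiff_const)) fun y => ?_
    -- The base points agree only propositionally and the vectors come from different pointed plots,
    -- so they are compared by differentials.
    refine tangent_ext (congrArg xAxis (by simp)) ?_ ?_
    · refine (differentialAt_fst_axisTangent _ _).trans ?_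
      refine Eq.trans ?_ (differentialAt_plotTangent dSmooth_fst _ isPlotOn_xAxis _ _).symm
      refine Eq.trans ?_ (fderiv_coord _ _).symm
      simp [sumInl, plane₁]
    · refine (differentialAt_snd_axisTangent _ _).trans ?_
      refine Eq.trans ?_ (differentialAt_plotTangent dSmooth_snd _ isPlotOn_xAxis _ _).symm
      exact (fderiv_zero_apply _ _).symm
  · refine IsPlot.congr ((tangentBundle Axes).isPseudoBundle.smooth_zero n _
      (isPlot_yAxis n q hq)) fun y => ?_
    exact congrArg (Sigma.mk (yAxis (q y))) (map_zero (axisTangent _))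

lemma dSmooth_axisTangent_inr :
    @DSmooth _ _ diffeology₂ _ (axisTangentTotal ∘ sumInr E₁ E₂) := by
  let := NormedSpace.toDiffeology (ℝ × ℝ)
  refine dSmooth_glued (fun n q hq => ?_) fun n q hq => ?_
  · refine IsPlot.congr ((tangentBundle Axes).isPseudoBundle.smooth_zero n _
      (isPlot_xAxis n q hq)) fun y => ?_
    exact congrArg (Sigma.mk (xAxis (q y))) (map_zero (axisTangent _))
  · have hq : ContDiff ℝ ∞ q := hq
    refine IsPlot.congr (isPlot_plotTangent isOpen_univ isPlotOn_yAxis (fun _ => trivial)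
      (a := fun y => (q y).1 • unitVec) (v := fun y => (q y).2 • unitVec)
      (hq.fst.smul contDiff_const) (hq.snd.smul contDiff_const)) fun y => ?_
    refine tangent_ext (congrArg yAxis (by simp)) ?_ ?_
    · refine (differentialAt_fst_axisTangent _ _).trans ?_
      refine Eq.trans ?_ (differentialAt_plotTangent dSmooth_fst _ isPlotOn_yAxis _ _).symm
      -- Along the second axis the first coordinate is the zero function by definition.
      exact (fderiv_zero_apply _ _).symm
    · refine (differentialAt_snd_axisTangent _ _).trans ?_
      refine Eq.trans ?_ (differentialAt_plotTangent dSmooth_snd _ isPlotOn_yAxis _ _).symm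
      refine Eq.trans ?_ (fderiv_coord _ _).symm
      simp [sumInr, plane₂]

lemma dSmooth_axisTangent :
    @DSmooth _ _ (directSum E₁ E₂).diffeology (tangentBundle Axes).diffeology axisTangentTotal :=
  dSmooth_dvsification (tangentBundle Axes) axisTangent
    (gluedDiffeology_le (d := pullbackDiffeology axisTangentTotal)
      dSmooth_axisTangent_inl dSmooth_axisTangent_inr)

end DiffBundle

theorem proposition5p1 :
    DiffBundle.Isomorphic (DiffBundle.tangentBundle DiffBundle.Axes)
      (DiffBundle.directSum DiffBundle.E₁ DiffBundle.E₂) :=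
  ⟨⟨DiffBundle.coordDifferential, DiffBundle.dSmooth_coordDifferential⟩,
    ⟨DiffBundle.axisTangent, DiffBundle.dSmooth_axisTangent⟩,
    DiffBundle.axisTangent_coordDifferential, DiffBundle.coordDifferential_axisTangent⟩
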